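/- Let $A\in\mathbb{C}^{n\times n}$ satisfy $\mu_2(A)\le 0$, where $\mu_2(A)=\max\{\operatorname{Re}(y^*Ay/y^*y) : 0\neq y\in\mathbb{C}^n\}$ is the logarithmic norm. Let $v\in\mathbb{C}^n$ and $m\ge 1$ be such that $v,Av,\dots,A^{m-1}v$ are linearly independent, and put $\beta=\|v\|_2$. Let $v_1,v_2,\dots$ be the vectors produced from $A$ and $v$ by the Arnoldi method in exact arithmetic: $v_1=v/\beta$, and $v_{k+1}=w_k/\|w_k\|_2$ with $w_k=Av_k-\sum_{i=1}^{k}(v_i^*Av_k)\,v_i$ (where $v_{k+1}=0$ if $w_k=0$). Let $V_m=(v_1,\dots,v_m)$, $H_m=V_m^*AV_m$, $h_{m+1,m}=(H_{m+1})_{m+1,m}\ge 0$ and $\gamma_m=\prod_{j=1}^{m-1}(H_m)_{j+1,j}>0$. For $p\in\mathbb{N}_0$ let $\varphi_p(z)=\sum_{k\ge 0} z^k/(k+p)!$, for scalars and for square matrices $z$, and write $(\varphi_p)_t(x)=\varphi_p(tx)$. For $t>0$ let $$l_{p,m}(t)=\beta V_m\varphi_p(tH_m)e_1-\varphi_p(tA)v$$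 be the error of the Krylov propagator. Let $\lambda_j=\xi_j+\mathrm{i}\eta_j$, $j=1,\dots,m$, be the eigenvalues of $H_m$, counted with algebraic multiplicity (the Ritz values). Then for all $p\in\mathbb{N}_0$ and $t>0$, $$\|l_{p,m}(t)\|_2\;\le\;\beta\,h_{m+1,m}\,\gamma_m\,t\,(\varphi_{p+1})_t[\xi_1,\dots,\xi_m],$$ where $f[\xi_1,\dots,\xi_m]$ denotes the divided difference of $f$ over the nodes $\xi_1,\dots,\xi_m$, in the confluent sense if nodes coincide. -/

import Mathlib

namespace KrylovPhi

/-- The function `φ_p`, by its series `∑ a ^ k / (k + p)!`. It is used on real numbers and on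
square complex matrices (both are topological `ℚ`-algebras where the series converges). -/
noncomputable def phi {𝔸 : Type*} [Ring 𝔸] [Algebra ℚ 𝔸] [TopologicalSpace 𝔸] (p : ℕ) (a : 𝔸) : 𝔸 :=
  ∑' k : ℕ, ((Nat.factorial (k + p) : ℚ)⁻¹) • a ^ k

/-- The numerical range `{y* A y / y* y : y ≠ 0}`. -/
def numericalRange {n : ℕ} (A : Matrix (Fin n) (Fin n) ℂ) : Set ℂ :=
  {z | ∃ y : Fin n → ℂ, y ≠ 0 ∧ z = (star y ⬝ᵥ A.mulVec y) / (star y ⬝ᵥ y)}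

/-- The logarithmic norm `μ₂(A) = max {Re z : z ∈ W(A)}`. For `n ≥ 1` the set is non-empty and
compact, so that the supremum is attained. -/
noncomputable def logNorm {n : ℕ} (A : Matrix (Fin n) (Fin n) ℂ) : ℝ :=
  sSup (Complex.re '' numericalRange A)

/-- The vectors `v₁, v₂, …` (indexed from `0`) of the Arnoldi method in exact arithmetic, started
with `v`: `A v_k` is orthogonalized against all earlier vectors and then normalized. The method
produces the zero vector after a breakdown. -/
noncomputable def arnoldiVec {n : ℕ} (A : Matrix (Fin n) (Fin n) ℂ)
    (v : EuclideanSpace ℂ (Fin n)) : ℕ → EuclideanSpace ℂ (Fin n)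
  | 0 => ((‖v‖⁻¹ : ℝ) : ℂ) • v
  | k + 1 =>
    let w : EuclideanSpace ℂ (Fin n) :=
      Matrix.toEuclideanLin A (arnoldiVec A v k) -
        ∑ i : Fin (k + 1),
          inner ℂ (arnoldiVec A v i) (Matrix.toEuclideanLin A (arnoldiVec A v k)) •
            arnoldiVec A v i
    ((‖w‖⁻¹ : ℝ) : ℂ) • w
termination_by k => k
decreasing_by all_goals omega

/-- `V_m`, the matrix with columns `v₁, …, v_m`. -/
noncomputable def arnoldiV {n : ℕ} (A : Matrix (Fin n) (Fin n) ℂ)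
    (v : EuclideanSpace ℂ (Fin n)) (m : ℕ) : Matrix (Fin n) (Fin m) ℂ :=
  Matrix.of fun i j => arnoldiVec A v j i

/-- `H_m = V_m* A V_m`. -/
noncomputable def arnoldiH {n : ℕ} (A : Matrix (Fin n) (Fin n) ℂ)
    (v : EuclideanSpace ℂ (Fin n)) (m : ℕ) : Matrix (Fin m) (Fin m) ℂ :=
  (arnoldiV A v m).conjTranspose * A * arnoldiV A v m

/-- The vectors of the Arnoldi method are pairwise orthogonal. -/
theorem arnoldiVec_orthogonal {n : ℕ} (A : Matrix (Fin n) (Fin n) ℂ)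
    (v : EuclideanSpace ℂ (Fin n)) (k : ℕ) :
    ∀ i < k, inner ℂ (arnoldiVec A v i) (arnoldiVec A v k) = 0 := by
  induction k using Nat.strong_induction_on with
  | _ k ih =>
    intro i hi
    obtain ⟨k, rfl⟩ : ∃ j, k = j + 1 := ⟨k - 1, by omega⟩
    have hself : ∀ (w x : EuclideanSpace ℂ (Fin n)),
        inner ℂ (((‖w‖⁻¹ : ℝ) : ℂ) • w) x * inner ℂ (((‖w‖⁻¹ : ℝ) : ℂ) • w)
          (((‖w‖⁻¹ : ℝ) : ℂ) • w) = inner ℂ (((‖w‖⁻¹ : ℝ) : ℂ) • w) x := by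
      intro w x
      by_cases hw : w = 0
      · simp [hw]
      · have : ‖((‖w‖⁻¹ : ℝ) : ℂ) • w‖ = 1 := by
          rw [norm_smul, Complex.norm_real, norm_inv, norm_norm,
            inv_mul_cancel₀ (norm_ne_zero_iff.2 hw)]
        rw [inner_self_eq_norm_sq_to_K, this]
        simp
    have hq : ∀ x, inner ℂ (arnoldiVec A v i) x *
        inner ℂ (arnoldiVec A v i) (arnoldiVec A v i) = inner ℂ (arnoldiVec A v i) x := by
      intro x
      cases i with
      | zero => rw [arnoldiVec]; exact hself _ _
      | succ i => rw [arnoldiVec]; exact hself _ _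
    rw [arnoldiVec, inner_smul_right]
    refine mul_eq_zero_of_right _ ?_
    rw [inner_sub_right, inner_sum, Finset.sum_eq_single (⟨i, hi⟩ : Fin (k + 1))]
    · rw [inner_smul_right, hq, sub_self]
    · intro j _ hj
      have hji : (j : ℕ) ≠ i := fun h => hj (Fin.ext h)
      rw [inner_smul_right]
      rcases lt_or_gt_of_ne hji with h | h
      · rw [← inner_conj_symm (arnoldiVec A v i) (arnoldiVec A v j), ih i hi j h]; simp
      · rw [ih j j.2 i h]; simp
    · simp

/-- The entries of `H_m` are `v_i* A v_j`. -/
theorem arnoldiH_apply {n : ℕ} (A : Matrix (Fin n) (Fin n) ℂ)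
    (v : EuclideanSpace ℂ (Fin n)) (m : ℕ) (i j : Fin m) :
    arnoldiH A v m i j =
      inner ℂ (arnoldiVec A v i) (Matrix.toEuclideanLin A (arnoldiVec A v j)) := by
  simp only [arnoldiH, Matrix.mul_assoc, Matrix.mul_apply (M := (arnoldiV A v m).conjTranspose),
    PiLp.inner_apply]
  refine Finset.sum_congr rfl fun a _ => ?_
  simp [arnoldiV, Matrix.mul_apply, Matrix.mulVec, dotProduct, mul_comm]

/-- The subdiagonal entry `(H_{k+2})_{k+2,k+1}` is real and non-negative: it is the norm of the
vector that the Arnoldi method normalizes. -/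
theorem arnoldiH_subdiag {n : ℕ} (A : Matrix (Fin n) (Fin n) ℂ)
    (v : EuclideanSpace ℂ (Fin n)) (k : ℕ) :
    arnoldiH A v (k + 2) (Fin.last (k + 1)) ⟨k, by omega⟩ =
      ((‖Matrix.toEuclideanLin A (arnoldiVec A v k) -
        ∑ i : Fin (k + 1),
          inner ℂ (arnoldiVec A v i) (Matrix.toEuclideanLin A (arnoldiVec A v k)) •
            arnoldiVec A v i‖ : ℝ) : ℂ) := by
  rw [arnoldiH_apply]
  simp only [Fin.val_last]
  set w := Matrix.toEuclideanLin A (arnoldiVec A v k) -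
        ∑ i : Fin (k + 1),
          inner ℂ (arnoldiVec A v i) (Matrix.toEuclideanLin A (arnoldiVec A v k)) •
            arnoldiVec A v i with hw
  have h1 : inner ℂ (arnoldiVec A v (k + 1)) w =
      inner ℂ (arnoldiVec A v (k + 1)) (Matrix.toEuclideanLin A (arnoldiVec A v k)) := by
    rw [hw, inner_sub_right, inner_sum, Finset.sum_eq_zero, sub_zero]
    intro i _
    rw [inner_smul_right, ← inner_conj_symm (arnoldiVec A v (k + 1)) (arnoldiVec A v i),
      arnoldiVec_orthogonal A v (k + 1) i i.2]
    simp
  rw [← h1]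
  have h2 : arnoldiVec A v (k + 1) = ((‖w‖⁻¹ : ℝ) : ℂ) • w := by rw [arnoldiVec]
  rw [h2, inner_smul_left, inner_self_eq_norm_sq_to_K, Complex.conj_ofReal]
  by_cases h0 : ‖w‖ = 0
  · simp [h0]
  · push_cast
    have : ((‖w‖ : ℝ) : ℂ) ≠ 0 := by exact_mod_cast h0
    simp only [Complex.coe_algebraMap]
    field_simp

/-- The entry `h_{k+1,k} = (H_{k+1})_{k+1,k}` for `k = 1, 2, …`, as a real number. The complex
entry is real, see `arnoldiH_subdiag`. (For `k = 0` there is no such entry and the value is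
not used.) -/
noncomputable def arnoldiSubdiag {n : ℕ} (A : Matrix (Fin n) (Fin n) ℂ)
    (v : EuclideanSpace ℂ (Fin n)) (k : ℕ) : ℝ :=
  (arnoldiH A v (k + 1) (Fin.last k) ⟨k - 1, by omega⟩).re

/-- `γ_m = ∏_{j=1}^{m-1} (H_m)_{j+1,j}`. -/
noncomputable def arnoldiGamma {n : ℕ} (A : Matrix (Fin n) (Fin n) ℂ)
    (v : EuclideanSpace ℂ (Fin n)) (m : ℕ) : ℝ :=
  ∏ j ∈ Finset.Icc 1 (m - 1), arnoldiSubdiag A v j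

/-- The error `l_{p,m}(t) = β V_m φ_p(t H_m) e₁ - φ_p(t A) v` of the Krylov propagator, with
`β = ‖v‖₂`. -/
noncomputable def krylovError {n : ℕ} (A : Matrix (Fin n) (Fin n) ℂ)
    (v : EuclideanSpace ℂ (Fin n)) (p m : ℕ) [NeZero m] (t : ℝ) : EuclideanSpace ℂ (Fin n) :=
  WithLp.toLp 2
    ((‖v‖ : ℂ) • (arnoldiV A v m).mulVec
        ((phi p ((t : ℂ) • arnoldiH A v m)).mulVec (Pi.single 0 1))
      - (phi p ((t : ℂ) • A)).mulVec v.ofLp)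

/-- Confluent divided difference `f[x₀, …, x_k]` over nodes in increasing order, by the usual
recursion. For such nodes `x_k = x₀` means that all nodes coincide. -/
noncomputable def dividedDiffSorted (f : ℝ → ℝ) : (k : ℕ) → (Fin (k + 1) → ℝ) → ℝ
  | 0, x => f (x 0)
  | k + 1, x =>
    if x (Fin.last (k + 1)) = x 0 then iteratedDeriv (k + 1) f (x 0) / (Nat.factorial (k + 1) : ℝ)
    else (dividedDiffSorted f k (Fin.tail x) - dividedDiffSorted f k (Fin.init x)) /
      (x (Fin.last (k + 1)) - x 0)

/-- Confluent divided difference `f[x₁, …, x_m]` over arbitrary real nodes (`m ≥ 1`). It does not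
depend on the order of the nodes, so they are put into increasing order first. -/
noncomputable def dividedDiff (f : ℝ → ℝ) : {m : ℕ} → (Fin m → ℝ) → ℝ
  | 0, _ => 0
  | k + 1, x => dividedDiffSorted f k (x ∘ Tuple.sort x)

end KrylovPhi

/-!
Every function of `t` in the argument is an exponential generating function
`egf c t = ∑ t ^ N / N! • c N`, and differentiation in `t` shifts the sequence `c`. Preceding `c`
by `p` zeros (`pad p c`) integrates `p` times from `0`, and `t ^ p φ_p (t M)` is of this form with
`c N = M ^ N` (`pow_smul_map_phi`).

For the exponential function the error satisfies
`l' = A l - β h_{m+1,m} (exp (t H_m))_{m,1} v_{m+1}` and `l 0 = 0`.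
On the level of power series this is `errorCoeff_succ`, which follows from the Arnoldi
decomposition `A V_m = V_m H_m + h_{m+1,m} v_{m+1} e_m*`. As `H_m` is a Hessenberg matrix,
the Newton form of `X ^ N` over the Ritz values and the Cayley–Hamilton theorem show that
`(exp (t H_m))_{m,1}` is `γ_m` times the divided difference of `z ↦ exp (t z)` over the Ritz values
(`hessenberg_pow_last_zero`).

As functions of `t`, these divided differences solve a triangular system of linear differential
equations, and a comparison of the systems for the nodes `λ_j` and `ξ_j = Re λ_j` bounds them by
the divided differences over the real parts (`norm_egf_powDiff_le`). Since `μ₂(A) ≤ 0`, the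
semigroup `exp (s A)` consists of contractions (`norm_exp_smul_apply_le`), so that variation of
constants bounds the error for `p = 0`; integrating `p` times gives the bound for `φ_p`
(`norm_egf_pad_le`). What bounds the error is thus the generating function of the divided
differences of monomials over the `ξ_j`, integrated `p + 1` times, and this is `t ^ (p + 1)` times
the divided difference of `x ↦ φ_{p+1} (t x)` (`pow_mul_dividedDiff_phi`).

The divided differences are taken over nodes in increasing order of their real parts, so that
their symmetry is not needed: the Ritz values are permuted instead.
-/

namespace KrylovPhi

/-! ### Exponential generating functions -/

/-- A sequence that is bounded by a geometric one, so that its exponential generating function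
is entire. -/
def ExpGrowth {E : Type*} [Norm E] (c : ℕ → E) : Prop :=
  ∃ C R : ℝ, 0 ≤ C ∧ 0 ≤ R ∧ ∀ N, ‖c N‖ ≤ C * R ^ N

/-- The exponential generating function `∑ t ^ N / N! • c N` of a sequence of vectors. -/
noncomputable def egf {E : Type*} [NormedAddCommGroup E] [NormedSpace ℝ E] (c : ℕ → E) (t : ℝ) :
    E :=
  ∑' N : ℕ, (t ^ N / (N.factorial : ℝ)) • c N

/-- The sequence `c`, preceded by `p` zeros. -/
def pad {E : Type*} [Zero E] (p : ℕ) (c : ℕ → E) (N : ℕ) : E :=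
  if N < p then 0 else c (N - p)

section ExpGrowth

variable {E : Type*} [NormedAddCommGroup E]

theorem ExpGrowth.succ {c : ℕ → E} (hc : ExpGrowth c) : ExpGrowth fun N => c (N + 1) := by
  obtain ⟨C, R, hC, hR, h⟩ := hc
  exact ⟨C * R, R, by positivity, hR, fun N => (h (N + 1)).trans_eq (by ring)⟩

theorem ExpGrowth.pad {c : ℕ → E} (hc : ExpGrowth c) (p : ℕ) : ExpGrowth (pad p c) := by
  obtain ⟨C, R, hC, hR, h⟩ := hc
  refine ⟨C, max R 1, hC, by positivity, fun N => ?_⟩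
  unfold KrylovPhi.pad
  split_ifs with hN
  · simp only [norm_zero]; positivity
  · calc ‖c (N - p)‖ ≤ C * R ^ (N - p) := h _
      _ ≤ C * max R 1 ^ (N - p) := by gcongr; exact le_max_left _ _
      _ ≤ C * max R 1 ^ N := by
        gcongr
        · exact le_max_right _ _
        · omega

theorem ExpGrowth.sub {c d : ℕ → E} (hc : ExpGrowth c) (hd : ExpGrowth d) :
    ExpGrowth fun N => c N - d N := by
  obtain ⟨C, R, hC, hR, h⟩ := hc
  obtain ⟨D, S, hD, hS, h'⟩ := hd
  refine ⟨C + D, max R S, by positivity, by positivity, fun N => ?_⟩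
  calc ‖c N - d N‖ ≤ ‖c N‖ + ‖d N‖ := norm_sub_le _ _
    _ ≤ C * R ^ N + D * S ^ N := add_le_add (h N) (h' N)
    _ ≤ C * max R S ^ N + D * max R S ^ N := by
      gcongr
      · exact le_max_left _ _
      · exact le_max_right _ _
    _ = _ := by ring

theorem pad_zero {E : Type*} [Zero E] (c : ℕ → E) : pad 0 c = c := by
  ext N; simp [pad]

theorem pad_succ_succ {E : Type*} [Zero E] (p : ℕ) (c : ℕ → E) :
    (fun N => pad (p + 1) c (N + 1)) = pad p c := by
  ext N; simp [pad]

variable {F : Type*} [NormedSpace ℝ E] [NormedAddCommGroup F] [NormedSpace ℝ F]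

theorem ExpGrowth.map {c : ℕ → E} (hc : ExpGrowth c) (φ : E →L[ℝ] F) :
    ExpGrowth fun N => φ (c N) := by
  obtain ⟨C, R, hC, hR, h⟩ := hc
  refine ⟨‖φ‖ * C, R, by positivity, hR, fun N => ?_⟩
  calc ‖φ (c N)‖ ≤ ‖φ‖ * ‖c N‖ := φ.le_opNorm _
    _ ≤ ‖φ‖ * (C * R ^ N) := by gcongr; exact h N
    _ = _ := by ring

theorem expGrowth_pow {R : Type*} [NormedRing R] (a : R) : ExpGrowth fun N => a ^ N := by
  refine ⟨max ‖(1 : R)‖ 1, ‖a‖, by positivity, norm_nonneg a, fun N => ?_⟩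
  cases N with
  | zero => simp
  | succ N =>
    calc ‖a ^ (N + 1)‖ ≤ ‖a‖ ^ (N + 1) := norm_pow_le' a N.succ_pos
      _ ≤ _ := le_mul_of_one_le_left (by positivity) (le_max_right _ _)

theorem ExpGrowth.summable [CompleteSpace E] {c : ℕ → E} (hc : ExpGrowth c) (t : ℝ) :
    Summable fun N : ℕ => (t ^ N / (N.factorial : ℝ)) • c N := by
  obtain ⟨C, R, hC, hR, h⟩ := hc
  refine Summable.of_norm_bounded ((Real.summable_pow_div_factorial (|t| * R)).mul_left C)
    fun N => ?_
  rw [norm_smul, norm_div, norm_pow, Real.norm_eq_abs, Real.norm_natCast, mul_pow]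
  calc |t| ^ N / (N.factorial : ℝ) * ‖c N‖ ≤ |t| ^ N / (N.factorial : ℝ) * (C * R ^ N) := by
        gcongr; exact h N
    _ = _ := by ring

theorem egf_zero (c : ℕ → E) : egf c 0 = c 0 := by
  rw [egf, tsum_eq_single 0]
  · simp
  · intro N hN
    simp [hN]

theorem egf_map [CompleteSpace E] {c : ℕ → E} (hc : ExpGrowth c) (φ : E →L[ℝ] F) (t : ℝ) :
    egf (fun N => φ (c N)) t = φ (egf c t) := by
  rw [egf, egf, φ.map_tsum (hc.summable t)]
  simp

theorem egf_sub [CompleteSpace E] {c d : ℕ → E} (hc : ExpGrowth c) (hd : ExpGrowth d) (t : ℝ) :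
    egf (fun N => c N - d N) t = egf c t - egf d t := by
  simp only [egf, smul_sub]
  exact (hc.summable t).tsum_sub (hd.summable t)

theorem egf_add [CompleteSpace E] {c d : ℕ → E} (hc : ExpGrowth c) (hd : ExpGrowth d) (t : ℝ) :
    egf (fun N => c N + d N) t = egf c t + egf d t := by
  simp only [egf, smul_add]
  exact (hc.summable t).tsum_add (hd.summable t)

/-- Differentiating an exponential generating function shifts the sequence. -/
theorem hasDerivAt_egf [CompleteSpace E] {c : ℕ → E} (hc : ExpGrowth c) (t : ℝ) :
    HasDerivAt (egf c) (egf (fun N => c (N + 1)) t) t := by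
  have hterm : ∀ (N : ℕ) (s : ℝ), HasDerivAt (fun s : ℝ => (s ^ N / (N.factorial : ℝ)) • c N)
      ((N * s ^ (N - 1) / (N.factorial : ℝ)) • c N) s := fun N s =>
    ((hasDerivAt_pow N s).div_const _).smul_const _
  have hsucc : ∀ (N : ℕ) (s : ℝ),
      ((N + 1 : ℕ) * s ^ (N + 1 - 1) / ((N + 1).factorial : ℝ)) • c (N + 1) =
        (s ^ N / (N.factorial : ℝ)) • c (N + 1) := by
    intro N s
    congr 1
    rw [Nat.factorial_succ]
    push_cast
    have : (N.factorial : ℝ) ≠ 0 := by positivity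
    have : (N : ℝ) + 1 ≠ 0 := by positivity
    field_simp
  obtain ⟨C, R, hC, hR, h⟩ := hc.succ
  set r : ℝ := |t| + 1
  have hr : 0 ≤ r := by positivity
  -- a bound for the derivatives of the terms, uniform in the ball of radius `|t| + 1`
  have hu : Summable fun N : ℕ => N * r ^ (N - 1) / (N.factorial : ℝ) * ‖c N‖ := by
    rw [← summable_nat_add_iff 1]
    refine Summable.of_nonneg_of_le (fun N => by positivity) (fun N => ?_)
      ((Real.summable_pow_div_factorial (r * R)).mul_left C)
    have h1 := congrArg norm (hsucc N r)
    rw [norm_smul, norm_smul, Real.norm_of_nonneg (by positivity),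
      Real.norm_of_nonneg (by positivity)] at h1
    rw [h1, mul_pow]
    calc r ^ N / (N.factorial : ℝ) * ‖c (N + 1)‖ ≤ r ^ N / (N.factorial : ℝ) * (C * R ^ N) := by
          gcongr; exact h N
      _ = _ := by ring
  have hmem : t ∈ Metric.ball (0 : ℝ) r := by simp [r]
  have key := hasDerivAt_tsum_of_isPreconnected hu Metric.isOpen_ball
    (convex_ball (0 : ℝ) r).isPreconnected (fun N s _ => hterm N s)
    (fun N s hs => by
      have hs' : |s| ≤ r := by simpa using (mem_ball_zero_iff.1 hs).le
      rw [norm_smul, norm_div, norm_mul, norm_pow, Real.norm_natCast, Real.norm_natCast,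
        Real.norm_eq_abs]
      gcongr)
    hmem (hc.summable t) hmem
  have hshift : (∑' N : ℕ, (N * t ^ (N - 1) / (N.factorial : ℝ)) • c N) =
      egf (fun N => c (N + 1)) t := by
    rw [egf, tsum_eq_zero_add']
    · simp only [hsucc]; simp
    · simp only [hsucc]; exact hc.succ.summable t
  rwa [hshift] at key

theorem egf_pad_succ_zero (p : ℕ) (c : ℕ → E) : egf (pad (p + 1) c) 0 = 0 := by
  rw [egf_zero]; simp [pad]

theorem hasDerivAt_egf_pad_succ [CompleteSpace E] {c : ℕ → E} (hc : ExpGrowth c) (p : ℕ) (t : ℝ) :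
    HasDerivAt (egf (pad (p + 1) c)) (egf (pad p c) t) t := by
  simpa only [pad_succ_succ] using hasDerivAt_egf (hc.pad (p + 1)) t

theorem egf_pad [CompleteSpace E] {c : ℕ → E} (hc : ExpGrowth c) (p : ℕ) (t : ℝ) :
    egf (pad p c) t = t ^ p • ∑' N : ℕ, (t ^ N / ((N + p).factorial : ℝ)) • c N := by
  have hs := (hc.pad p).summable t
  rw [egf, ← hs.sum_add_tsum_nat_add p, Finset.sum_eq_zero, zero_add, ← tsum_const_smul'']
  · refine tsum_congr fun N => ?_
    simp only [pad, Nat.add_sub_cancel, smul_smul]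
    rw [if_neg (by omega)]
    congr 1
    ring
  · intro N hN
    simp [pad, Finset.mem_range.1 hN]

end ExpGrowth

/-- A function on `[0, ∞)` is bounded in norm by `B` if this holds at `0` and its derivative is
bounded in norm by that of `B`. -/
theorem norm_le_of_norm_deriv_le {E : Type*} [NormedAddCommGroup E] [NormedSpace ℝ E]
    {f f' : ℝ → E} {B B' : ℝ → ℝ} {T : ℝ} (hT : 0 ≤ T) (hf : ∀ s, HasDerivAt f (f' s) s)
    (hB : ∀ s, HasDerivAt B (B' s) s) (h0 : ‖f 0‖ ≤ B 0)
    (h : ∀ s, 0 ≤ s → s ≤ T → ‖f' s‖ ≤ B' s) : ‖f T‖ ≤ B T :=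
  image_norm_le_of_norm_deriv_right_le_deriv_boundary
    (fun s _ => (hf s).continuousAt.continuousWithinAt) (fun s _ => (hf s).hasDerivWithinAt) h0 hB
    (fun s hs => h s hs.1 hs.2.le) (Set.right_mem_Icc.2 hT)

/-- The semigroup of an operator with non-positive real part consists of contractions. -/
theorem norm_exp_smul_apply_le {E : Type*} [NormedAddCommGroup E] [InnerProductSpace ℂ E]
    [CompleteSpace E] (A : E →L[ℂ] E) (hA : ∀ x, (inner ℂ x (A x)).re ≤ 0) {s : ℝ} (hs : 0 ≤ s)
    (x : E) : ‖NormedSpace.exp (s • A) x‖ ≤ ‖x‖ := by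
  let _ : InnerProductSpace ℝ E := InnerProductSpace.rclikeToReal ℂ E
  have hd : ∀ s : ℝ, HasDerivAt (fun s : ℝ => NormedSpace.exp (s • A) x)
      (A (NormedSpace.exp (s • A) x)) s := fun s =>
    ((ContinuousLinearMap.apply ℂ E x).restrictScalars ℝ).hasFDerivAt.comp_hasDerivAt s
      (hasDerivAt_exp_smul_const' (𝕂 := ℝ) A s)
  have hanti : Antitone fun s : ℝ => ‖NormedSpace.exp (s • A) x‖ ^ 2 := by
    refine antitone_of_hasDerivAt_nonpos (fun s => (hd s).norm_sq) fun s => ?_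
    have := hA (NormedSpace.exp (s • A) x)
    have h2 : inner ℝ (NormedSpace.exp (s • A) x) (A (NormedSpace.exp (s • A) x)) ≤ 0 := this
    exact mul_nonpos_of_nonneg_of_nonpos zero_le_two h2
  have := hanti hs
  simp only [zero_smul, NormedSpace.exp_zero] at this
  exact (pow_le_pow_iff_left₀ (norm_nonneg _) (norm_nonneg _) two_ne_zero).1 this

/-! ### Divided differences of monomials and of entire functions -/

/-- The divided difference of the monomial `X ^ N` over the first `k + 1` nodes `x 0, …, x k`,
by the Leibniz rule for the product `X ^ (N + 1) = X ^ N * X`. -/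
def powDiff {R : Type*} [CommRing R] (x : ℕ → R) : ℕ → ℕ → R
  | 0, 0 => 1
  | 0, _ + 1 => 0
  | N + 1, 0 => x 0 * powDiff x N 0
  | N + 1, k + 1 => x (k + 1) * powDiff x N (k + 1) + powDiff x N k

section powDiff

variable {R : Type*} [CommRing R]

theorem powDiff_succ_zero (x : ℕ → R) (N : ℕ) :
    powDiff x (N + 1) 0 = x 0 * powDiff x N 0 := rfl

theorem powDiff_succ_succ (x : ℕ → R) (N k : ℕ) :
    powDiff x (N + 1) (k + 1) = x (k + 1) * powDiff x N (k + 1) + powDiff x N k := rfl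

/-- The Leibniz rule for `X * X ^ N`. -/
theorem powDiff_succ_succ' (x : ℕ → R) (N k : ℕ) :
    powDiff x (N + 1) (k + 1) =
      x 0 * powDiff x N (k + 1) + powDiff (fun i => x (i + 1)) N k := by
  induction N generalizing k with
  | zero => cases k <;> simp [powDiff]
  | succ N ih =>
    cases k with
    | zero =>
      linear_combination powDiff_succ_succ x (N + 1) 0 + x 1 * ih 0 -
        x 0 * powDiff_succ_succ x N 0 + powDiff_succ_zero x N -
        powDiff_succ_zero (fun i => x (i + 1)) N
    | succ k =>
      linear_combination powDiff_succ_succ x (N + 1) (k + 1) + x (k + 2) * ih (k + 1) + ih k -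
        x 0 * powDiff_succ_succ x N (k + 1) - powDiff_succ_succ (fun i => x (i + 1)) N k

/-- The recursion of divided differences. -/
theorem powDiff_recursion (x : ℕ → R) (N k : ℕ) :
    (x (k + 1) - x 0) * powDiff x N (k + 1) =
      powDiff (fun i => x (i + 1)) N k - powDiff x N k := by
  linear_combination powDiff_succ_succ' x N k - powDiff_succ_succ x N k

theorem powDiff_congr {x y : ℕ → R} {k : ℕ} (h : ∀ i ≤ k, x i = y i) (N : ℕ) :
    powDiff x N k = powDiff y N k := by
  induction N generalizing k with
  | zero => cases k <;> rfl
  | succ N ih =>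
    cases k with
    | zero => rw [powDiff, powDiff, h 0 le_rfl, ih h]
    | succ k => rw [powDiff, powDiff, h (k + 1) le_rfl, ih h, ih fun i hi => h i (by omega)]

theorem powDiff_eq_zero (x : ℕ → R) {N k : ℕ} (h : N < k) : powDiff x N k = 0 := by
  induction N generalizing k with
  | zero => cases k with
    | zero => omega
    | succ k => rfl
  | succ N ih => cases k with
    | zero => omega
    | succ k => rw [powDiff, ih (by omega), ih (by omega)]; ring

theorem powDiff_const (a : R) (N k : ℕ) :
    powDiff (fun _ => a) (N + k) k = ((N + k).choose k : R) * a ^ N := by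
  induction N generalizing k with
  | zero =>
    induction k with
    | zero => simp [powDiff]
    | succ k ih =>
      rw [← add_assoc, powDiff, powDiff_eq_zero _ (by omega), ih]
      simp
  | succ N ihN =>
    induction k with
    | zero =>
      have := ihN 0
      simp only [add_zero] at this ⊢
      rw [powDiff, this]; simp; ring
    | succ k ih =>
      rw [← add_assoc, powDiff, ih, show N + 1 + k = N + (k + 1) by omega, ihN (k + 1),
        Nat.choose_succ_succ]
      push_cast; ring

/-- The Newton form of `X ^ N`. -/
theorem X_pow_eq_sum_powDiff (x : ℕ → R) (N : ℕ) :
    (Polynomial.X : Polynomial R) ^ N = ∑ k ∈ Finset.range (N + 1),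
      Polynomial.C (powDiff x N k) * ∏ i ∈ Finset.range k, (Polynomial.X - Polynomial.C (x i)) := by
  induction N with
  | zero => simp [powDiff]
  | succ N ih =>
    rw [Finset.sum_range_succ', pow_succ, ih, Finset.sum_mul]
    simp only [powDiff, Polynomial.C_add, Polynomial.C_mul, add_mul, Finset.sum_add_distrib]
    rw [Finset.sum_range_succ (fun k => Polynomial.C (x (k + 1)) * _ * _),
      powDiff_eq_zero x (Nat.lt_succ_self N)]
    have h := Finset.sum_range_succ' (fun k => Polynomial.C (x k) * Polynomial.C (powDiff x N k) *
      ∏ i ∈ Finset.range k, (Polynomial.X - Polynomial.C (x i))) N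
    simp only [map_zero, mul_zero, zero_mul, add_zero]
    rw [add_right_comm, ← h, ← Finset.sum_add_distrib]
    refine Finset.sum_congr rfl fun k _ => ?_
    rw [Finset.prod_range_succ]
    ring

end powDiff

theorem expGrowth_powDiff {R : Type*} [NormedCommRing R] [NormOneClass R] (x : ℕ → R) (k : ℕ) :
    ExpGrowth fun N => powDiff x N k := by
  set S : ℝ := 1 + ∑ i ∈ Finset.range (k + 1), ‖x i‖ with hS
  have hS1 : 1 ≤ S := le_add_of_nonneg_right (by positivity)
  have hx : ∀ i ≤ k, 1 + ‖x i‖ ≤ S := fun i hi => by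
    rw [hS]
    gcongr
    exact Finset.single_le_sum (f := fun i => ‖x i‖) (fun _ _ => norm_nonneg _)
      (Finset.mem_range.2 (by omega))
  refine ⟨1, S, zero_le_one, by positivity, fun N => ?_⟩
  suffices ∀ j ≤ k, ‖powDiff x N j‖ ≤ S ^ N by simpa using this k le_rfl
  induction N with
  | zero => intro j _; cases j <;> simp [powDiff]
  | succ N ih =>
    intro j hj
    cases j with
    | zero =>
      rw [powDiff]
      calc ‖x 0 * powDiff x N 0‖ ≤ ‖x 0‖ * ‖powDiff x N 0‖ := norm_mul_le _ _
        _ ≤ S * S ^ N := by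
          gcongr
          · linarith [hx 0 hj]
          · exact ih 0 hj
        _ = _ := by ring
    | succ j =>
      rw [powDiff]
      calc ‖x (j + 1) * powDiff x N (j + 1) + powDiff x N j‖
          ≤ ‖x (j + 1)‖ * ‖powDiff x N (j + 1)‖ + ‖powDiff x N j‖ :=
            (norm_add_le _ _).trans (by gcongr; exact norm_mul_le _ _)
        _ ≤ ‖x (j + 1)‖ * S ^ N + S ^ N := by
          gcongr
          · exact ih _ hj
          · exact ih _ (by omega)
        _ = (1 + ‖x (j + 1)‖) * S ^ N := by ring
        _ ≤ S * S ^ N := by gcongr; exact hx _ hj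
        _ = _ := by ring

section hasDerivAt

variable {R : Type*} [NormedCommRing R] [NormedAlgebra ℝ R] [CompleteSpace R]

theorem egf_const_mul {c : ℕ → R} (hc : ExpGrowth c) (a : R) (t : ℝ) :
    egf (fun N => a * c N) t = a * egf c t :=
  egf_map hc (ContinuousLinearMap.mul ℝ R a) t

variable [NormOneClass R]

theorem hasDerivAt_egf_powDiff_zero (x : ℕ → R) (t : ℝ) :
    HasDerivAt (egf fun N => powDiff x N 0) (x 0 * egf (fun N => powDiff x N 0) t) t := by
  have h := hasDerivAt_egf (expGrowth_powDiff x 0) t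
  simp only [powDiff] at h
  rwa [egf_const_mul (expGrowth_powDiff x 0)] at h

theorem hasDerivAt_egf_powDiff_succ (x : ℕ → R) (k : ℕ) (t : ℝ) :
    HasDerivAt (egf fun N => powDiff x N (k + 1))
      (x (k + 1) * egf (fun N => powDiff x N (k + 1)) t + egf (fun N => powDiff x N k) t) t := by
  have h := hasDerivAt_egf (expGrowth_powDiff x (k + 1)) t
  simp only [powDiff] at h
  rwa [egf_add _ (expGrowth_powDiff x k), egf_const_mul (expGrowth_powDiff x (k + 1))] at h
  exact (expGrowth_powDiff x (k + 1)).map (ContinuousLinearMap.mul ℝ R (x (k + 1)))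

end hasDerivAt

/-- Multiplication by an integrating factor. -/
theorem hasDerivAt_exp_mul {f : ℝ → ℂ} {f' : ℂ} {s : ℝ} (a : ℂ) (hf : HasDerivAt f f' s) :
    HasDerivAt (fun s : ℝ => Complex.exp (-(a * s)) * f s)
      (Complex.exp (-(a * s)) * (f' - a * f s)) s := by
  have h1 : HasDerivAt (fun s : ℝ => Complex.exp (-(a * s)))
      (Complex.exp (-(a * s)) * -(a * 1)) s :=
    (((hasDerivAt_id (s : ℂ)).const_mul a).neg.cexp).comp_ofReal
  exact (h1.mul hf).congr_deriv (by ring)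

theorem hasDerivAt_rexp_mul {f : ℝ → ℝ} {f' s : ℝ} (a : ℝ) (hf : HasDerivAt f f' s) :
    HasDerivAt (fun s : ℝ => Real.exp (-(a * s)) * f s)
      (Real.exp (-(a * s)) * (f' - a * f s)) s := by
  have h1 : HasDerivAt (fun s : ℝ => Real.exp (-(a * s)))
      (Real.exp (-(a * s)) * -(a * 1)) s :=
    ((hasDerivAt_id s).const_mul a).neg.exp
  exact (h1.mul hf).congr_deriv (by ring)

/-- The divided differences of `z ↦ exp (t z)` over complex nodes are bounded by those over the
real parts of the nodes: as functions of `t`, they solve the differential equations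
`f_{k+1}' = x_{k+1} f_{k+1} + f_k`, and these are compared after multiplication by the
integrating factor `exp (- t x_{k+1})`. -/
theorem norm_egf_powDiff_le (x : ℕ → ℂ) (k : ℕ) {t : ℝ} (ht : 0 ≤ t) :
    ‖egf (fun N => powDiff x N k) t‖ ≤ egf (fun N => powDiff (fun i => (x i).re) N k) t := by
  have hexp : ∀ i (s : ℝ), ‖Complex.exp (-(x i * s))‖ = Real.exp (-((x i).re * s)) := by
    intro i s
    simp [Complex.norm_exp]
  have cancel : ∀ i (f : ℂ) (g : ℝ),
      ‖Complex.exp (-(x i * t)) * f‖ ≤ Real.exp (-((x i).re * t)) * g → ‖f‖ ≤ g := by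
    intro i f g h
    rw [norm_mul, hexp] at h
    exact le_of_mul_le_mul_left h (Real.exp_pos _)
  induction k generalizing t with
  | zero =>
    refine cancel 0 _ _ (norm_le_of_norm_deriv_le ht
      (fun s => hasDerivAt_exp_mul (x 0) (hasDerivAt_egf_powDiff_zero x s))
      (fun s => hasDerivAt_rexp_mul (x 0).re (hasDerivAt_egf_powDiff_zero _ s)) ?_ ?_)
    · simp [egf_zero, powDiff]
    · intro s _ _
      simp
  | succ k ih =>
    refine cancel (k + 1) _ _ (norm_le_of_norm_deriv_le ht
      (fun s => hasDerivAt_exp_mul (x (k + 1)) (hasDerivAt_egf_powDiff_succ x k s))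
      (fun s => hasDerivAt_rexp_mul (x (k + 1)).re (hasDerivAt_egf_powDiff_succ _ k s)) ?_ ?_)
    · simp [egf_zero, powDiff]
    · intro s hs _
      rw [norm_mul, hexp, add_sub_cancel_left, add_sub_cancel_left]
      gcongr
      refine ih hs ?_
      intro i f g h
      rw [norm_mul, hexp] at h
      exact le_of_mul_le_mul_left h (Real.exp_pos _)

theorem ExpGrowth.mul {R : Type*} [NormedRing R] {c d : ℕ → R} (hc : ExpGrowth c)
    (hd : ExpGrowth d) : ExpGrowth fun N => c N * d N := by
  obtain ⟨C, R, hC, hR, h⟩ := hc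
  obtain ⟨D, S, hD, hS, h'⟩ := hd
  refine ⟨C * D, R * S, by positivity, by positivity, fun N => ?_⟩
  calc ‖c N * d N‖ ≤ ‖c N‖ * ‖d N‖ := norm_mul_le _ _
    _ ≤ (C * R ^ N) * (D * S ^ N) := by
      gcongr
      · exact h N
      · exact h' N
    _ = _ := by rw [mul_pow]; ring

theorem iteratedDeriv_egf {c : ℕ → ℝ} (hc : ExpGrowth c) (k : ℕ) :
    iteratedDeriv k (egf c) = egf fun N => c (N + k) := by
  induction k generalizing c with
  | zero => simp
  | succ k ih =>
    rw [iteratedDeriv_succ', show deriv (egf c) = egf fun N => c (N + 1) from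
      funext fun t => (hasDerivAt_egf hc t).deriv, ih hc.succ]
    rfl

theorem egf_mul_powDiff_const {c : ℕ → ℝ} (hc : ExpGrowth c) (a : ℝ) (k : ℕ) :
    egf (fun N => c N * powDiff (fun _ => a) N k) 1 =
      egf (fun N => c (N + k)) a / (k.factorial : ℝ) := by
  have hs := (hc.mul (expGrowth_powDiff (fun _ => a) k)).summable 1
  rw [egf, ← hs.sum_add_tsum_nat_add k, Finset.sum_eq_zero, zero_add, egf, ← tsum_div_const]
  · refine tsum_congr fun N => ?_
    rw [powDiff_const, ← Nat.add_choose_mul_factorial_mul_factorial N k, add_comm N k,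
      Nat.choose_symm_add]
    have h1 : ((k + N).choose N : ℝ) ≠ 0 :=
      Nat.cast_ne_zero.2 (Nat.choose_pos (by omega)).ne'
    push_cast
    simp only [smul_eq_mul, one_pow]
    field_simp
  · intro N hN
    rw [powDiff_eq_zero _ (Finset.mem_range.1 hN)]
    simp

/-- Divided differences of an entire function, term by term. -/
theorem dividedDiffSorted_egf {c : ℕ → ℝ} (hc : ExpGrowth c) (k : ℕ) (x : Fin (k + 1) → ℝ)
    (hx : Monotone x) (y : ℕ → ℝ) (hy : ∀ i : Fin (k + 1), y i = x i) :
    dividedDiffSorted (egf c) k x = egf (fun N => c N * powDiff y N k) 1 := by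
  induction k generalizing y with
  | zero =>
    have h : ∀ N, powDiff y N 0 = x 0 ^ N := by
      intro N
      induction N with
      | zero => simp [powDiff]
      | succ N ih => rw [powDiff, ih, ← hy 0, pow_succ']; rfl
    rw [dividedDiffSorted, egf, egf]
    refine tsum_congr fun N => ?_
    rw [h]
    simp only [smul_eq_mul, one_pow]
    ring
  | succ k ih =>
    rw [dividedDiffSorted]
    split_ifs with heq
    · have h : ∀ i ≤ k + 1, y i = x 0 := fun i hi => by
        have h0 := hx (Fin.zero_le (⟨i, by omega⟩ : Fin (k + 2)))
        have h1 := hx (Fin.le_last (⟨i, by omega⟩ : Fin (k + 2)))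
        exact (hy ⟨i, by omega⟩).trans (le_antisymm (h1.trans_eq heq) h0)
      simp only [fun N => powDiff_congr h N]
      rw [iteratedDeriv_egf hc, egf_mul_powDiff_const hc]
    · rw [ih (Fin.tail x) (fun i j h => hx (Fin.succ_le_succ_iff.2 h)) (fun i => y (i + 1))
          (fun i => hy i.succ),
        ih (Fin.init x) (fun i j h => hx (Fin.castSucc_le_castSucc_iff.2 h)) y
          (fun i => hy i.castSucc), div_eq_iff (sub_ne_zero.2 heq),
        ← egf_sub (hc.mul (expGrowth_powDiff _ k)) (hc.mul (expGrowth_powDiff _ k)), mul_comm,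
        ← egf_const_mul (hc.mul (expGrowth_powDiff _ _))]
      congr 1
      ext N
      have h0 : y 0 = x 0 := hy 0
      have h1 : y (k + 1) = x (Fin.last (k + 1)) := hy (Fin.last (k + 1))
      rw [← h0, ← h1, ← mul_sub, ← powDiff_recursion]
      ring

/-- Up to a power of `t`, the divided difference of `x ↦ φ_p (t x)` is an exponential generating
function in `t`. -/
theorem pow_mul_dividedDiff_phi {k : ℕ} (x : Fin (k + 1) → ℝ) (y : ℕ → ℝ)
    (hy : ∀ i : Fin (k + 1), y i = x (Tuple.sort x i)) (p : ℕ) (t : ℝ) :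
    t ^ p * dividedDiff (fun x : ℝ => phi p (t * x)) x = egf (pad p fun N => powDiff y N k) t := by
  set c : ℕ → ℝ := fun N => t ^ N * (N.factorial / (N + p).factorial : ℝ) with hc_def
  have hc : ExpGrowth c := by
    refine (expGrowth_pow t).mul ⟨1, 1, zero_le_one, zero_le_one, fun N => ?_⟩
    rw [Real.norm_of_nonneg (by positivity), one_pow, mul_one, div_le_one (by positivity)]
    exact_mod_cast Nat.factorial_le (Nat.le_add_right N p)
  have hf : (fun x : ℝ => phi p (t * x)) = egf c := by
    ext x
    rw [phi, egf]
    refine tsum_congr fun N => ?_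
    rw [hc_def, Rat.smul_def, mul_pow]
    push_cast
    simp only [smul_eq_mul]
    field_simp
  rw [hf, egf_pad (expGrowth_powDiff y k), dividedDiff,
    dividedDiffSorted_egf hc k _ (Tuple.monotone_sort x) y hy, smul_eq_mul, egf]
  congr 1
  refine tsum_congr fun N => ?_
  simp only [hc_def, smul_eq_mul, one_pow]
  field_simp

/-! ### Hessenberg matrices and the Arnoldi decomposition -/

section Matrix

attribute [local instance] Matrix.linftyOpNormedRing Matrix.linftyOpNormedAlgebra

theorem expGrowth_map_pow {k : ℕ} {E : Type*} [NormedAddCommGroup E] [NormedSpace ℝ E]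
    (Φ : Matrix (Fin k) (Fin k) ℂ →ₗ[ℝ] E) (M : Matrix (Fin k) (Fin k) ℂ) :
    ExpGrowth fun N => Φ (M ^ N) :=
  (expGrowth_pow M).map Φ.toContinuousLinearMap

/-- Up to a power of `t`, a linear image of `φ_p (t M)` is an exponential generating function
in `t`. -/
theorem pow_smul_map_phi {k : ℕ} {E : Type*} [NormedAddCommGroup E] [NormedSpace ℝ E]
    [CompleteSpace E]
    (Φ : Matrix (Fin k) (Fin k) ℂ →ₗ[ℝ] E) (M : Matrix (Fin k) (Fin k) ℂ) (p : ℕ) (t : ℝ) :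
    t ^ p • Φ (phi p ((t : ℂ) • M)) = egf (pad p fun N => Φ (M ^ N)) t := by
  have h := egf_map ((expGrowth_pow M).pad p) Φ.toContinuousLinearMap t
  have hpad : (fun N => Φ.toContinuousLinearMap (pad p (fun N => M ^ N) N)) =
      pad p fun N => Φ (M ^ N) := by
    ext N
    simp only [pad]
    split_ifs <;> simp
  have hphi : t ^ p • phi p ((t : ℂ) • M) = egf (pad p fun N => M ^ N) t := by
    rw [egf_pad (expGrowth_pow M)]
    refine congrArg (fun B => t ^ p • B) (tsum_congr fun N => ?_)
    ext i j
    simp [smul_pow, Rat.smul_def]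
    ring
  exact (Φ.map_smul (t ^ p) _).symm.trans
    ((congrArg Φ hphi).trans (h.symm.trans (congrArg (fun c => egf c t) hpad)))

end Matrix

section Hessenberg

variable {R : Type*} [CommRing R] {m : ℕ} {H : Matrix (Fin (m + 1)) (Fin (m + 1)) R} {s : ℕ → R}

theorem hessenberg_pow_apply_zero (hH : ∀ i j : Fin (m + 1), (j : ℕ) + 1 < i → H i j = 0)
    (hs : ∀ i j : Fin (m + 1), (i : ℕ) = j + 1 → H i j = s j) (N : ℕ) (i : Fin (m + 1))
    (hi : N ≤ i) : (H ^ N) i 0 = if (i : ℕ) = N then ∏ j ∈ Finset.range N, s j else 0 := by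
  induction N generalizing i with
  | zero =>
    by_cases h : i = 0
    · simp [h]
    · rw [pow_zero, Matrix.one_apply_ne h, if_neg (fun h' : (i : ℕ) = 0 => h (Fin.ext h'))]
  | succ N ih =>
    rw [pow_succ', Matrix.mul_apply, Finset.sum_eq_single (⟨N, by omega⟩ : Fin (m + 1))]
    · rw [ih _ le_rfl, if_pos rfl]
      split_ifs with h
      · rw [hs _ _ h, Finset.prod_range_succ, mul_comm]
      · rw [hH _ _ (show N + 1 < (i : ℕ) by omega), zero_mul]
    · intro j _ hj
      have hj' : (j : ℕ) ≠ N := fun h => hj (Fin.ext h)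
      rcases lt_or_ge ((j : ℕ) + 1) i with h | h
      · rw [hH _ _ h, zero_mul]
      · rw [ih j (by omega), if_neg hj', mul_zero]
    · simp

theorem hessenberg_aeval_last_zero (hH : ∀ i j : Fin (m + 1), (j : ℕ) + 1 < i → H i j = 0)
    (hs : ∀ i j : Fin (m + 1), (i : ℕ) = j + 1 → H i j = s j) {f : Polynomial R}
    (hf : f.natDegree ≤ m) :
    Polynomial.aeval H f (Fin.last m) 0 = f.coeff m * ∏ j ∈ Finset.range m, s j := by
  rw [Polynomial.aeval_eq_sum_range' (Nat.lt_succ_of_le hf), Matrix.sum_apply,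
    Finset.sum_range_succ, Finset.sum_eq_zero, zero_add]
  · rw [Matrix.smul_apply, hessenberg_pow_apply_zero hH hs m _ le_rfl, if_pos (Fin.val_last m),
      smul_eq_mul]
  · intro k hk
    have hk' := Finset.mem_range.1 hk
    rw [Matrix.smul_apply, hessenberg_pow_apply_zero hH hs k _ hk'.le, if_neg, smul_zero]
    exact hk'.ne'

/-- The lower left entry of `H ^ N`, for a Hessenberg matrix `H`, is up to the product of the
subdiagonal entries the divided difference of `X ^ N` over the eigenvalues: in the Newton form of
`X ^ N` the terms of degree less than `m` do not reach that entry, and the terms of degree greater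
than `m` vanish at `H` by the Cayley–Hamilton theorem. -/
theorem hessenberg_pow_last_zero [Nontrivial R]
    (hH : ∀ i j : Fin (m + 1), (j : ℕ) + 1 < i → H i j = 0)
    (hs : ∀ i j : Fin (m + 1), (i : ℕ) = j + 1 → H i j = s j) {x : ℕ → R}
    (hx : H.charpoly = ∏ i ∈ Finset.range (m + 1), (Polynomial.X - Polynomial.C (x i))) (N : ℕ) :
    (H ^ N) (Fin.last m) 0 = powDiff x N m * ∏ j ∈ Finset.range m, s j := by
  have hmonic : ∀ k, (∏ i ∈ Finset.range k, (Polynomial.X - Polynomial.C (x i))).Monic := fun k =>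
    Polynomial.monic_prod_of_monic _ _ fun i _ => Polynomial.monic_X_sub_C _
  have hdeg : ∀ k, (∏ i ∈ Finset.range k, (Polynomial.X - Polynomial.C (x i))).natDegree = k :=
    fun k => by
      rw [Polynomial.natDegree_prod_of_monic _ _ fun i _ => Polynomial.monic_X_sub_C _]
      simp
  have h := congrArg (fun f => Polynomial.aeval H f (Fin.last m) 0) (X_pow_eq_sum_powDiff x N)
  simp only [map_pow, Polynomial.aeval_X, map_sum, map_mul, Matrix.sum_apply, Polynomial.aeval_C,
    Algebra.algebraMap_eq_smul_one, smul_mul_assoc, one_mul, Matrix.smul_apply, smul_eq_mul] at h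
  rw [h, Finset.sum_eq_single m]
  · rw [hessenberg_aeval_last_zero hH hs (hdeg m).le]
    have := hmonic m
    rw [Polynomial.Monic, Polynomial.leadingCoeff, hdeg] at this
    rw [this, one_mul]
  · intro k _ hk
    rcases lt_or_gt_of_ne hk with hk | hk
    · rw [hessenberg_aeval_last_zero hH hs ((hdeg k).trans_le hk.le),
        Polynomial.coeff_eq_zero_of_natDegree_lt ((hdeg k).trans_lt hk), zero_mul, mul_zero]
    · have hdvd : H.charpoly ∣ ∏ i ∈ Finset.range k, (Polynomial.X - Polynomial.C (x i)) := by
        rw [hx]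
        exact Finset.prod_dvd_prod_of_subset _ _ _ (Finset.range_subset_range.2 hk)
      obtain ⟨g, hg⟩ := hdvd
      rw [hg, map_mul, Matrix.aeval_self_charpoly, zero_mul, Matrix.zero_apply, mul_zero]
  · intro hm
    rw [powDiff_eq_zero x (by simpa using hm), zero_mul]

end Hessenberg

section Arnoldi

variable {n : ℕ} (A : Matrix (Fin n) (Fin n) ℂ) (v : EuclideanSpace ℂ (Fin n))

theorem arnoldiSubdiag_succ (k : ℕ) :
    arnoldiSubdiag A v (k + 1) = ‖Matrix.toEuclideanLin A (arnoldiVec A v k) -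
        ∑ i : Fin (k + 1),
          inner ℂ (arnoldiVec A v i) (Matrix.toEuclideanLin A (arnoldiVec A v k)) •
            arnoldiVec A v i‖ := by
  have h := congrArg Complex.re (arnoldiH_subdiag A v k)
  rwa [Complex.ofReal_re] at h

theorem inner_arnoldiVec_succ (k : ℕ) :
    inner ℂ (arnoldiVec A v (k + 1)) (Matrix.toEuclideanLin A (arnoldiVec A v k)) =
      (arnoldiSubdiag A v (k + 1) : ℂ) := by
  rw [arnoldiSubdiag_succ, ← arnoldiH_subdiag, arnoldiH_apply]
  simp

theorem arnoldiSubdiag_nonneg (k : ℕ) : 0 ≤ arnoldiSubdiag A v (k + 1) := by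
  rw [arnoldiSubdiag_succ]
  exact norm_nonneg _

theorem norm_arnoldiVec_le_one (k : ℕ) : ‖arnoldiVec A v k‖ ≤ 1 := by
  have h : ∀ w : EuclideanSpace ℂ (Fin n), ‖((‖w‖⁻¹ : ℝ) : ℂ) • w‖ ≤ 1 := fun w => by
    rw [norm_smul, Complex.norm_real, norm_inv, norm_norm]
    exact inv_mul_le_one
  cases k with
  | zero => rw [arnoldiVec]; exact h v
  | succ k => rw [arnoldiVec]; exact h _

theorem norm_smul_arnoldiVec_zero : (‖v‖ : ℂ) • arnoldiVec A v 0 = v := by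
  rw [arnoldiVec, smul_smul]
  by_cases hv : v = 0
  · simp [hv]
  · have : (‖v‖ : ℂ) ≠ 0 := by simpa using hv
    push_cast
    rw [mul_inv_cancel₀ this, one_smul]

/-- One step of the Arnoldi recursion. -/
theorem toEuclideanLin_arnoldiVec (k : ℕ) :
    Matrix.toEuclideanLin A (arnoldiVec A v k) =
      ∑ i ∈ Finset.range (k + 1),
        inner ℂ (arnoldiVec A v i) (Matrix.toEuclideanLin A (arnoldiVec A v k)) •
          arnoldiVec A v i + (arnoldiSubdiag A v (k + 1) : ℂ) • arnoldiVec A v (k + 1) := by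
  rw [arnoldiSubdiag_succ, Finset.sum_range fun i =>
    inner ℂ (arnoldiVec A v i) (Matrix.toEuclideanLin A (arnoldiVec A v k)) • arnoldiVec A v i]
  have h2 := arnoldiVec.eq_2 A v k
  rw [h2]
  set w := Matrix.toEuclideanLin A (arnoldiVec A v k) -
        ∑ i : Fin (k + 1),
          inner ℂ (arnoldiVec A v i) (Matrix.toEuclideanLin A (arnoldiVec A v k)) •
            arnoldiVec A v i with hw
  have : (‖w‖ : ℂ) • ((‖w‖⁻¹ : ℝ) : ℂ) • w = w := by
    rw [smul_smul]
    by_cases h0 : w = 0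
    · simp [h0]
    · have : (‖w‖ : ℂ) ≠ 0 := by simpa using h0
      push_cast
      rw [mul_inv_cancel₀ this, one_smul]
  rw [this, hw, add_sub_cancel]

theorem inner_arnoldiVec_eq_zero {i k : ℕ} (h : k + 1 < i) :
    inner ℂ (arnoldiVec A v i) (Matrix.toEuclideanLin A (arnoldiVec A v k)) = 0 := by
  have h0 : ∀ j < i, inner ℂ (arnoldiVec A v i) (arnoldiVec A v j) = 0 := fun j hj => by
    rw [← inner_conj_symm, arnoldiVec_orthogonal A v i j hj, map_zero]
  rw [toEuclideanLin_arnoldiVec, inner_add_right, inner_sum, inner_smul_right, h0 _ h, mul_zero,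
    add_zero]
  refine Finset.sum_eq_zero fun j hj => ?_
  rw [inner_smul_right, h0 j (by have := Finset.mem_range.1 hj; omega), mul_zero]

/-- The Arnoldi decomposition `A V_m = V_m H_m + h_{m+1,m} v_{m+1} e_m*`, by columns. -/
theorem toEuclideanLin_arnoldiVec_eq_sum (m : ℕ) (k : Fin (m + 1)) :
    Matrix.toEuclideanLin A (arnoldiVec A v k) =
      ∑ i : Fin (m + 1), arnoldiH A v (m + 1) i k • arnoldiVec A v i +
        (if k = Fin.last m then (arnoldiSubdiag A v (m + 1) : ℂ) else 0) •
          arnoldiVec A v (m + 1) := by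
  simp only [arnoldiH_apply]
  rw [← Finset.sum_range fun i =>
    inner ℂ (arnoldiVec A v i) (Matrix.toEuclideanLin A (arnoldiVec A v k)) • arnoldiVec A v i]
  split_ifs with hk
  · rw [hk]
    exact toEuclideanLin_arnoldiVec A v m
  · have hkm : (k : ℕ) < m := Fin.val_lt_last hk
    rw [zero_smul, add_zero]
    -- below the subdiagonal the coefficients vanish, and the subdiagonal one is the norm
    have hsub : Finset.range (k + 2) ⊆ Finset.range (m + 1) :=
      Finset.range_subset_range.2 (by omega)
    rw [← Finset.sum_subset hsub, Finset.sum_range_succ, inner_arnoldiVec_succ]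
    · exact toEuclideanLin_arnoldiVec A v k
    · intro i _ hi
      rw [inner_arnoldiVec_eq_zero A v (not_le.1 fun h => hi (Finset.mem_range.2 (by omega))),
        zero_smul]

theorem toLp_arnoldiV_mulVec (m : ℕ) (y : Fin m → ℂ) :
    WithLp.toLp 2 ((arnoldiV A v m).mulVec y) = ∑ j, y j • arnoldiVec A v j := by
  ext i
  simp [arnoldiV, Matrix.mulVec, dotProduct, mul_comm]

theorem toEuclideanLin_arnoldiV_mulVec (m : ℕ) (y : Fin (m + 1) → ℂ) :
    Matrix.toEuclideanLin A (WithLp.toLp 2 ((arnoldiV A v (m + 1)).mulVec y)) =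
      WithLp.toLp 2 ((arnoldiV A v (m + 1)).mulVec ((arnoldiH A v (m + 1)).mulVec y)) +
        (y (Fin.last m) * arnoldiSubdiag A v (m + 1)) • arnoldiVec A v (m + 1) := by
  rw [toLp_arnoldiV_mulVec, toLp_arnoldiV_mulVec, map_sum]
  simp only [map_smul]
  rw [Finset.sum_congr rfl fun k _ => by rw [toEuclideanLin_arnoldiVec_eq_sum A v m k]]
  simp only [smul_add, Finset.sum_add_distrib, Finset.smul_sum, Matrix.mulVec, dotProduct,
    Finset.sum_smul]
  congr 1
  · rw [Finset.sum_comm]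
    refine Finset.sum_congr rfl fun i _ => Finset.sum_congr rfl fun j _ => ?_
    rw [smul_smul, mul_comm]
  · rw [Finset.sum_eq_single (Fin.last m)]
    · rw [if_pos rfl, smul_smul]
    · intro k _ hk
      simp [hk]
    · simp

end Arnoldi

theorem re_inner_nonpos_of_logNorm_nonpos {n : ℕ} {A : Matrix (Fin n) (Fin n) ℂ}
    (hA : logNorm A ≤ 0) (x : EuclideanSpace ℂ (Fin n)) :
    (inner ℂ x (Matrix.toEuclideanLin A x)).re ≤ 0 := by
  set L := (Matrix.toEuclideanLin A).toContinuousLinearMap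
  have hinner : ∀ y : Fin n → ℂ,
      star y ⬝ᵥ A.mulVec y = inner ℂ (WithLp.toLp 2 y) (L (WithLp.toLp 2 y)) := by
    intro y
    rw [EuclideanSpace.inner_eq_star_dotProduct, dotProduct_comm]
    rfl
  have hnorm : ∀ y : Fin n → ℂ, star y ⬝ᵥ y = ((‖WithLp.toLp 2 y‖ ^ 2 : ℝ) : ℂ) := by
    intro y
    have := inner_self_eq_norm_sq_to_K (𝕜 := ℂ) (WithLp.toLp 2 y)
    simp only [Complex.coe_algebraMap] at this
    push_cast
    rw [← this, EuclideanSpace.inner_eq_star_dotProduct, dotProduct_comm]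
  -- without this bound the supremum in `logNorm` would be a junk value
  have hbdd : BddAbove (Complex.re '' numericalRange A) := by
    refine ⟨‖L‖, ?_⟩
    rintro _ ⟨_, ⟨y, hy, rfl⟩, rfl⟩
    have hpos : 0 < ‖WithLp.toLp 2 y‖ := by simpa using hy
    rw [hinner, hnorm, Complex.div_ofReal_re, div_le_iff₀ (by positivity)]
    calc _ ≤ ‖inner ℂ (WithLp.toLp 2 y) (L (WithLp.toLp 2 y))‖ := Complex.re_le_norm _
      _ ≤ ‖WithLp.toLp 2 y‖ * ‖L (WithLp.toLp 2 y)‖ := norm_inner_le_norm _ _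
      _ ≤ ‖WithLp.toLp 2 y‖ * (‖L‖ * ‖WithLp.toLp 2 y‖) := by gcongr; exact L.le_opNorm _
      _ = _ := by ring
  by_cases hx : x = 0
  · simp [hx]
  · have h := (le_csSup hbdd ⟨_, ⟨x.ofLp, by simpa using hx, rfl⟩, rfl⟩).trans hA
    have hpos : 0 < ‖x‖ := norm_pos_iff.2 hx
    rw [hinner, hnorm, Complex.div_ofReal_re, div_le_iff₀ (by positivity), zero_mul] at h
    exact h

/-! ### The error of the Krylov propagator -/

/-- A bound for the solution `f = egf d` of `f' = A f - c D u`, `f 0 = 0`, and for its iterated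
integrals `egf (pad p d)`, where `A` is dissipative and `D` is a divided difference of the
exponential function. -/
theorem norm_egf_pad_le {E : Type*} [NormedAddCommGroup E] [InnerProductSpace ℂ E]
    [CompleteSpace E] {A : E →L[ℂ] E} (hA : ∀ x, (inner ℂ x (A x)).re ≤ 0) {u : E} (hu : ‖u‖ ≤ 1)
    {c : ℝ} (hc : 0 ≤ c) {x : ℕ → ℂ} {k : ℕ} {d : ℕ → E} (hd : ExpGrowth d) (hd0 : d 0 = 0)
    (hrec : ∀ N, d (N + 1) = A (d N) - (c * powDiff x N k : ℂ) • u) (p : ℕ) {t : ℝ}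
    (ht : 0 ≤ t) :
    ‖egf (pad p d) t‖ ≤ c * egf (pad (p + 1) fun N => powDiff (fun i => (x i).re) N k) t := by
  have hq := expGrowth_powDiff x k
  have hq' := expGrowth_powDiff (fun i => (x i).re) k
  induction p generalizing t with
  | succ p ih =>
    refine norm_le_of_norm_deriv_le ht (fun s => hasDerivAt_egf_pad_succ hd p s)
      (fun s => (hasDerivAt_egf_pad_succ hq' (p + 1) s).const_mul c) ?_ fun s hs _ => ih hs
    simp [egf_pad_succ_zero]
  | zero =>
    rw [pad_zero]
    let Aℝ : E →L[ℝ] E := A.restrictScalars ℝ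
    let φ : ℂ →L[ℝ] E :=
      ((ContinuousLinearMap.toSpanSingleton ℂ u).restrictScalars ℝ) ∘L
        (ContinuousLinearMap.mul ℝ ℂ c)
    have hderiv : ∀ s, HasDerivAt (egf d)
        (A (egf d s) - (c * egf (fun N => powDiff x N k) s) • u) s := by
      intro s
      have h := hasDerivAt_egf hd s
      have heq : (fun N => d (N + 1)) = fun N => Aℝ (d N) - φ (powDiff x N k) := funext hrec
      rwa [heq, egf_sub (hd.map Aℝ) (hq.map φ), egf_map hd, egf_map hq] at h
    -- variation of constants: the function below is `0` at `s = 0` and `egf d t` at `s = t`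
    have hexp : ∀ s : ℝ, HasDerivAt (fun s : ℝ => (NormedSpace.exp ((t - s) • A)).restrictScalars ℝ)
        (-(NormedSpace.exp ((t - s) • A) * A).restrictScalars ℝ) s := by
      intro s
      have h := (hasDerivAt_exp_smul_const (𝕂 := ℝ) A (t - s)).scomp s
        ((hasDerivAt_id s).const_sub t)
      have h2 := (ContinuousLinearMap.restrictScalarsL ℂ E E ℝ ℝ).hasFDerivAt.comp_hasDerivAt s h
      refine h2.congr_deriv ?_
      ext y
      simp
    have key := norm_le_of_norm_deriv_le (B := fun t => c * egf (pad 1 fun N =>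
        powDiff (fun i => (x i).re) N k) t) ht
      (fun s => (hexp s).clm_apply (hderiv s))
      (fun s => (hasDerivAt_egf_pad_succ hq' 0 s).const_mul c)
      (by simp [egf_zero, hd0, pad]) (fun s hs hst => by
        rw [pad_zero]
        calc _ = ‖NormedSpace.exp ((t - s) • A)
              (-((c * egf (fun N => powDiff x N k) s) • u))‖ := by
              congr 1
              simp [map_sub]
              abel
          _ ≤ ‖-((c * egf (fun N => powDiff x N k) s) • u)‖ :=
              norm_exp_smul_apply_le A hA (sub_nonneg.2 hst) _
          _ = c * ‖egf (fun N => powDiff x N k) s‖ * ‖u‖ := by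
              rw [norm_neg, norm_smul, norm_mul, Complex.norm_real, Real.norm_of_nonneg hc]
          _ ≤ c * ‖egf (fun N => powDiff x N k) s‖ * 1 := by gcongr
          _ ≤ _ := by
              rw [mul_one]
              gcongr
              exact norm_egf_powDiff_le x k hs)
    simpa using key

/-- The map `B ↦ W B y` from matrices to vectors. It is taken over `ℝ`, as `egf` uses real
scalars. -/
noncomputable def sandwich {n k : ℕ} (W : Matrix (Fin n) (Fin k) ℂ) (y : Fin k → ℂ) :
    Matrix (Fin k) (Fin k) ℂ →ₗ[ℝ] EuclideanSpace ℂ (Fin n) where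
  toFun B := WithLp.toLp 2 (W.mulVec (B.mulVec y))
  map_add' B C := by simp [Matrix.add_mulVec, Matrix.mulVec_add]
  map_smul' r B := by simp [Matrix.smul_mulVec, Matrix.mulVec_smul]

theorem sandwich_apply {n k : ℕ} (W : Matrix (Fin n) (Fin k) ℂ) (y : Fin k → ℂ)
    (B : Matrix (Fin k) (Fin k) ℂ) :
    sandwich W y B = WithLp.toLp 2 (W.mulVec (B.mulVec y)) := rfl

/-- The coefficients `β V_{m+1} H_{m+1} ^ N e₁ - A ^ N v` of the expansion of the error after
`m + 1` steps in powers of `t`; they do not depend on `p`. -/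
noncomputable def errorCoeff {n : ℕ} (A : Matrix (Fin n) (Fin n) ℂ)
    (v : EuclideanSpace ℂ (Fin n)) (m N : ℕ) : EuclideanSpace ℂ (Fin n) :=
  (‖v‖ : ℂ) • sandwich (arnoldiV A v (m + 1)) (Pi.single 0 1) (arnoldiH A v (m + 1) ^ N) -
    sandwich (1 : Matrix (Fin n) (Fin n) ℂ) v.ofLp (A ^ N)

section errorCoeff

variable {n : ℕ} (A : Matrix (Fin n) (Fin n) ℂ) (v : EuclideanSpace ℂ (Fin n)) (m : ℕ)

theorem expGrowth_errorCoeff : ExpGrowth (errorCoeff A v m) := by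
  have h1 := expGrowth_map_pow (sandwich (arnoldiV A v (m + 1)) (Pi.single 0 1))
    (arnoldiH A v (m + 1))
  have h2 := expGrowth_map_pow (sandwich (1 : Matrix (Fin n) (Fin n) ℂ) v.ofLp) A
  exact (h1.map (((‖v‖ : ℂ) • ContinuousLinearMap.id ℂ
    (EuclideanSpace ℂ (Fin n))).restrictScalars ℝ)).sub h2

theorem errorCoeff_zero : errorCoeff A v m 0 = 0 := by
  simp only [errorCoeff, pow_zero, sandwich_apply, Matrix.one_mulVec, toLp_arnoldiV_mulVec]
  rw [Finset.sum_eq_single 0, Pi.single_eq_same, one_smul, Fin.val_zero,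
    norm_smul_arnoldiVec_zero, sub_self]
  · intro j _ hj
    rw [Pi.single_eq_of_ne hj, zero_smul]
  · simp

theorem pow_smul_krylovError (p : ℕ) (t : ℝ) :
    t ^ p • krylovError A v p (m + 1) t = egf (pad p (errorCoeff A v m)) t := by
  set Φ := sandwich (arnoldiV A v (m + 1)) (Pi.single 0 1)
  let β : EuclideanSpace ℂ (Fin n) →L[ℝ] EuclideanSpace ℂ (Fin n) :=
    ((‖v‖ : ℂ) • ContinuousLinearMap.id ℂ _).restrictScalars ℝ
  have h1 := pow_smul_map_phi Φ (arnoldiH A v (m + 1)) p t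
  have h2 := pow_smul_map_phi (sandwich (1 : Matrix (Fin n) (Fin n) ℂ) v.ofLp) A p t
  have hg1 := (expGrowth_map_pow Φ (arnoldiH A v (m + 1))).pad p
  have hg2 := (expGrowth_map_pow (sandwich (1 : Matrix (Fin n) (Fin n) ℂ) v.ofLp) A).pad p
  have hpad : pad p (errorCoeff A v m) = fun N =>
      β (pad p (fun N => Φ (arnoldiH A v (m + 1) ^ N)) N) -
        pad p (fun N => sandwich (1 : Matrix (Fin n) (Fin n) ℂ) v.ofLp (A ^ N)) N := by
    ext1 N
    simp only [pad]
    split_ifs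
    · simp
    · rfl
  rw [hpad, egf_sub (hg1.map β) hg2, egf_map hg1, ← h1, ← h2, map_smul, ← smul_sub]
  congr 1
  simp [krylovError, β, Φ, sandwich_apply]

theorem arnoldiGamma_eq_prod_range :
    arnoldiGamma A v (m + 1) = ∏ j ∈ Finset.range m, arnoldiSubdiag A v (j + 1) := by
  rw [arnoldiGamma, Finset.range_eq_Ico, Finset.prod_Ico_add' (fun j => arnoldiSubdiag A v j)]
  rfl

/-- The recursion for the coefficients of the error: by the Arnoldi decomposition its
inhomogeneity is the lower left entry of `H_m ^ N`, which is a divided difference. -/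
theorem errorCoeff_succ {x : ℕ → ℂ} (hx : (arnoldiH A v (m + 1)).charpoly =
      ∏ i ∈ Finset.range (m + 1), (Polynomial.X - Polynomial.C (x i))) (N : ℕ) :
    errorCoeff A v m (N + 1) = Matrix.toEuclideanLin A (errorCoeff A v m N) -
      (((‖v‖ * arnoldiSubdiag A v (m + 1) * arnoldiGamma A v (m + 1) : ℝ) : ℂ) *
        powDiff x N m) • arnoldiVec A v (m + 1) := by
  have hV := toEuclideanLin_arnoldiV_mulVec A v m
    ((arnoldiH A v (m + 1) ^ N).mulVec (Pi.single 0 1))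
  have hentry := hessenberg_pow_last_zero
    (H := arnoldiH A v (m + 1)) (s := fun j => (arnoldiSubdiag A v (j + 1) : ℂ))
    (fun i j h => by rw [arnoldiH_apply, inner_arnoldiVec_eq_zero A v h])
    (fun i j h => by rw [arnoldiH_apply, h, inner_arnoldiVec_succ]) hx N
  rw [Matrix.mulVec_single_one, Matrix.col_apply, hentry, ← Matrix.mulVec_single_one,
    Matrix.mulVec_mulVec _ (arnoldiH A v (m + 1)) (arnoldiH A v (m + 1) ^ N),
    ← pow_succ', ← Complex.ofReal_prod, ← arnoldiGamma_eq_prod_range] at hV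
  have hA : Matrix.toEuclideanLin A
      (WithLp.toLp 2 ((1 : Matrix (Fin n) (Fin n) ℂ).mulVec ((A ^ N).mulVec v.ofLp))) =
      WithLp.toLp 2 ((1 : Matrix (Fin n) (Fin n) ℂ).mulVec ((A ^ (N + 1)).mulVec v.ofLp)) := by
    rw [Matrix.one_mulVec, Matrix.one_mulVec, pow_succ', ← Matrix.mulVec_mulVec]
    rfl
  simp only [errorCoeff, sandwich_apply, map_sub, map_smul, hV, hA, smul_add, smul_smul]
  push_cast
  module

end errorCoeff
end KrylovPhi

theorem theorem4p1 (n : ℕ) (A : Matrix (Fin n) (Fin n) ℂ) (v : EuclideanSpace ℂ (Fin n))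
    (hA : KrylovPhi.logNorm A ≤ 0)
    (m : ℕ) [NeZero m]
    -- the Krylov vectors `v, A v, …, A ^ (m - 1) v` are linearly independent (no breakdown
    -- before step `m`)
    (hm : LinearIndependent ℂ fun k : Fin m => (A ^ (k : ℕ)).mulVec v.ofLp)
    -- the Ritz values, with multiplicities and in any order
    (l : Fin m → ℂ)
    (hl : (KrylovPhi.arnoldiH A v m).charpoly =
      ∏ j : Fin m, (Polynomial.X - Polynomial.C (l j)))
    (p : ℕ) (t : ℝ) (ht : 0 < t) :
    ‖KrylovPhi.krylovError A v p m t‖ ≤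
      ‖v‖ * KrylovPhi.arnoldiSubdiag A v m * KrylovPhi.arnoldiGamma A v m * t *
        KrylovPhi.dividedDiff (fun x : ℝ => KrylovPhi.phi (p + 1) (t * x))
          (fun j => (l j).re) := by
  obtain ⟨m, rfl⟩ : ∃ k, m = k + 1 := Nat.exists_eq_succ_of_ne_zero (NeZero.ne m)
  -- the Ritz values, ordered by their real parts and continued by zeros
  set σ := Tuple.sort fun j => (l j).re with hσ
  let x : ℕ → ℂ := fun i => if h : i < m + 1 then l (σ ⟨i, h⟩) else 0
  have hxl : ∀ i : Fin (m + 1), x i = l (σ i) := fun i => dif_pos i.2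
  have hx : (KrylovPhi.arnoldiH A v (m + 1)).charpoly =
      ∏ i ∈ Finset.range (m + 1), (Polynomial.X - Polynomial.C (x i)) := by
    rw [hl, Finset.prod_range fun i => Polynomial.X - Polynomial.C (x i),
      ← Equiv.prod_comp σ fun j => Polynomial.X - Polynomial.C (l j)]
    exact Finset.prod_congr rfl fun i _ => by rw [hxl]
  have hc : 0 ≤ ‖v‖ * KrylovPhi.arnoldiSubdiag A v (m + 1) *
      KrylovPhi.arnoldiGamma A v (m + 1) := by
    rw [KrylovPhi.arnoldiGamma_eq_prod_range]
    exact mul_nonneg (mul_nonneg (norm_nonneg v) (KrylovPhi.arnoldiSubdiag_nonneg A v m))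
      (Finset.prod_nonneg fun j _ => KrylovPhi.arnoldiSubdiag_nonneg A v j)
  have key := KrylovPhi.norm_egf_pad_le
    (A := (Matrix.toEuclideanLin A).toContinuousLinearMap)
    (KrylovPhi.re_inner_nonpos_of_logNorm_nonpos hA)
    (KrylovPhi.norm_arnoldiVec_le_one A v (m + 1)) hc
    (KrylovPhi.expGrowth_errorCoeff A v m) (KrylovPhi.errorCoeff_zero A v m)
    (KrylovPhi.errorCoeff_succ A v m hx) p ht.le
  rw [← KrylovPhi.pow_smul_krylovError, norm_smul, Real.norm_of_nonneg (by positivity),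
    ← KrylovPhi.pow_mul_dividedDiff_phi (fun j => (l j).re) (fun i => (x i).re)
      (fun i => by rw [hxl])] at key
  refine le_of_mul_le_mul_left (key.trans_eq ?_) (pow_pos ht p)
  ring
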